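/- Write $C_2=\{0,1\}$ and $C_n=\mathbb Z/n\mathbb Z$, and let $C_2\wr C_n=C_2^{C_n}\rtimes C_n$ be their wreath product, where $C_n$ acts on $C_2^{C_n}$ by translation of the coordinates and elements of $C_2^{C_n}$ are identified with subsets of $C_n$. For a metric space $(X,\rho)$, the distortion of a bi-Lipschitz map $f$ from $X$ into the complex Hilbert space $\mathcal H=\ell^2(\mathbb N)$ is $$\sup_{x\ne z}\frac{\|f(x)-f(z)\|}{\rho(x,z)}\cdot\sup_{x\ne z}\frac{\rho(x,z)}{\|f(x)-f(z)\|},$$ and $c_2(X,\rho)\in[0,\infty]$ is the infimum of the distortions of all bi-Lipschitz maps $f:X\to\mathcal H$ ($+\infty$ if there are none). There is a universal constant $c>0$ with the following property. For all large $n$, let $K_n$ be a nonempty set of integers $k$ with $100\log n\le k\le n$ (for example a single prescribed cardinality $k_n$, or all integers in this range), and let $S$ be a uniformly random subset of $C_n$ with cardinality $|S|\in K_n$. Then $S$ generates $C_n$ asymptotically almost surely, that is, with probability tending to $1$ as $n\to\infty$. Moreover, conditioned on the event that $S$ generates $C_n$, let $\rho$ be the left-invariant word metric on $C_2\wr C_n$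 for the generating set $(\{\emptyset\}\times S)\cup\{(\{0\},0)\}$, so that $\rho(x,y)$ is the least length of a word in the generators and their inverses that evaluates to $x^{-1}y$. Then, asymptotically almost surely, $$c_2(C_2\wr C_n,\rho)\ \ge\ c\sqrt n .$$ -/

import Mathlib

open Filter Topology
open scoped ENNReal

/-- A map is bi-Lipschitz if it and its inverse (defined on its image) are both Lipschitz. -/
def IsBiLipschitz {X Y : Type*} [EMetricSpace X] [EMetricSpace Y] (f : X → Y) : Prop :=
  (∃ K, LipschitzWith K f) ∧ (∃ K, AntilipschitzWith K f)

/-- The distortion of a map: its greatest expansion times the greatest expansion of its inverse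
(meaningful for bi-Lipschitz maps). -/
noncomputable def mapDistortion {X Y : Type*} [EMetricSpace X] [EMetricSpace Y]
    (f : X → Y) : ℝ≥0∞ :=
  (⨆ (x : X) (z : X) (_ : x ≠ z), edist (f x) (f z) / edist x z) *
    (⨆ (x : X) (z : X) (_ : x ≠ z), edist x z / edist (f x) (f z))

/-- The distortion of `X` into `Y`: the infimum of the distortions of the bi-Lipschitz maps
`X → Y`, and `∞` if there are none. -/
noncomputable def distortionInto (X Y : Type*) [EMetricSpace X] [EMetricSpace Y] : ℝ≥0∞ :=
  ⨅ (f : X → Y) (_ : IsBiLipschitz f), mapDistortion f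

/-- The Euclidean distortion `c₂(X)`: the distortion of `X` into the complex Hilbert space `ℓ²`. -/
noncomputable def euclideanDistortion (X : Type*) [EMetricSpace X] : ℝ≥0∞ :=
  distortionInto X (lp (fun _ : ℕ => ℂ) 2)

/-- A list of elements of `T` and inverses of elements of `T`. -/
def IsWordIn {G : Type*} [Group G] (T : Set G) (l : List G) : Prop :=
  ∀ a ∈ l, a ∈ T ∨ a⁻¹ ∈ T

/-- The length of a shortest word in the elements of `T` and their inverses that evaluates to `g`
(it is `∞` if there is no such word, which does not happen if `T` generates `G`). -/
noncomputable def wordLength {G : Type*} [Group G] (T : Set G) (g : G) : ℝ≥0∞ :=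
  ⨅ (l : List G) (_ : IsWordIn T l) (_ : l.prod = g), (l.length : ℝ≥0∞)

theorem wordLength_le {G : Type*} [Group G] {T : Set G} {l : List G} (hl : IsWordIn T l) :
    wordLength T l.prod ≤ l.length :=
  iInf_le_of_le l (iInf_le_of_le hl (iInf_le_of_le rfl le_rfl))

theorem wordLength_one {G : Type*} [Group G] (T : Set G) : wordLength T 1 = 0 := by
  have h := wordLength_le (T := T) (l := []) (by simp [IsWordIn])
  simpa using h

theorem wordLength_inv_le {G : Type*} [Group G] (T : Set G) (g : G) :
    wordLength T g⁻¹ ≤ wordLength T g := by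
  refine le_iInf fun l => le_iInf fun hl => le_iInf fun hg => ?_
  have h := wordLength_le (T := T) (l := (l.map fun a => a⁻¹).reverse) (by
    intro a ha
    simp only [List.mem_reverse, List.mem_map] at ha
    obtain ⟨b, hb, rfl⟩ := ha
    simpa using (hl b hb).symm)
  rw [← List.prod_inv_reverse, hg] at h
  simpa using h

theorem wordLength_mul_le {G : Type*} [Group G] (T : Set G) (g h : G) :
    wordLength T (g * h) ≤ wordLength T g + wordLength T h := by
  refine ENNReal.le_of_forall_pos_le_add fun ε hε hfin => ?_
  have hε' : (ε : ℝ≥0∞) / 2 ≠ 0 := by simpa using hε.ne'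
  obtain ⟨hg, hh⟩ := ENNReal.add_lt_top.1 hfin
  have h1 := ENNReal.lt_add_right hg.ne hε'
  have h2 := ENNReal.lt_add_right hh.ne hε'
  conv_lhs at h1 => rw [wordLength]
  conv_lhs at h2 => rw [wordLength]
  simp only [iInf_lt_iff] at h1 h2
  obtain ⟨l, hl, rfl, hl'⟩ := h1
  obtain ⟨m, hm, rfl, hm'⟩ := h2
  have h3 := wordLength_le (T := T) (l := l ++ m) (by
    intro a ha
    rcases List.mem_append.1 ha with ha | ha
    · exact hl a ha
    · exact hm a ha)
  rw [List.prod_append, List.length_append, Nat.cast_add] at h3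
  calc _ ≤ _ := h3
    _ ≤ _ := add_le_add hl'.le hm'.le
    _ = wordLength T l.prod + wordLength T m.prod + (ε / 2 + ε / 2) := by ring
    _ = _ := by rw [ENNReal.add_halves]

theorem eq_one_of_wordLength_eq_zero {G : Type*} [Group G] {T : Set G} {g : G}
    (h : wordLength T g = 0) : g = 1 := by
  have h1 : wordLength T g < 1 := by rw [h]; exact one_pos
  rw [wordLength] at h1
  simp only [iInf_lt_iff] at h1
  obtain ⟨l, -, rfl, hl⟩ := h1
  have hl0 : l.length = 0 := by
    have : l.length < 1 := by exact_mod_cast hl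
    omega
  simp [List.length_eq_zero_iff.1 hl0]

theorem eq_of_wordLength_eq_zero {G : Type*} [Group G] {T : Set G} {x y : G}
    (h : wordLength T (x⁻¹ * y) = 0) : x = y :=
  inv_mul_eq_one.1 (eq_one_of_wordLength_eq_zero h)

/-- The group `G`, as a space with the left-invariant word metric of the subset `T`. -/
def WordMetricSpace {G : Type*} [Group G] (_T : Set G) : Type _ := G

noncomputable instance {G : Type*} [Group G] (T : Set G) : EMetricSpace (WordMetricSpace T) where
  edist (x y : G) := wordLength T (x⁻¹ * y)
  edist_self (x : G) := by
    rw [inv_mul_cancel, wordLength_one]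
  edist_comm (x y : G) := by
    apply le_antisymm
    · simpa using wordLength_inv_le T (y⁻¹ * x)
    · simpa using wordLength_inv_le T (x⁻¹ * y)
  edist_triangle (x y z : G) := by
    simpa [mul_assoc] using wordLength_mul_le T (x⁻¹ * y) (y⁻¹ * z)
  eq_of_edist_eq_zero h := eq_of_wordLength_eq_zero (G := G) (T := T) h

/-- The cyclic group `C_n`, written multiplicatively. -/
abbrev CyclicGrp (n : ℕ) : Type := Multiplicative (ZMod n)

/-- The cyclic lamplighter group, the wreath product `C_2 ≀ C_n`. -/
abbrev Lamplighter (n : ℕ) : Type := RegularWreathProduct (CyclicGrp 2) (CyclicGrp n)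

/-- The generators of `C_2 ≀ C_n` given by `S ⊆ C_n`: the moves `(∅, s)` with `s ∈ S`,
and the change `({0}, 0)` of the lamp at the current position. -/
def lamplighterGenerators {n : ℕ} (S : Finset (CyclicGrp n)) : Set (Lamplighter n) :=
  {g | g.left = 1 ∧ g.right ∈ S} ∪ {⟨Pi.mulSingle 1 (Multiplicative.ofAdd 1), 1⟩}

/-- The subsets `S` of `C_n` whose cardinality `|S|` lies in `K`. -/
def cyclicSubsets (n : ℕ) (K : Set ℕ) : Set (Finset (CyclicGrp n)) := {S | S.card ∈ K}

/-- The subsets of `C_n` that generate `C_n`. -/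
def generatingSubsets (n : ℕ) : Set (Finset (CyclicGrp n)) :=
  {S | Subgroup.closure (S : Set (CyclicGrp n)) = ⊤}

/-- The probability that a uniformly random element of the finite set `A` lies in `E`. -/
noncomputable def uniformProb {Ω : Type*} (A E : Set Ω) : ℝ :=
  ((A ∩ E).ncard : ℝ) / (A.ncard : ℝ)

/-! Everything rests on the spectral gap `HasCharacterGap`. Let `f` move each generator edge by at
most `L`. By `HasCharacterGap.poincare`, for a fixed lamp configuration the mean square of the
difference of `f` at two positions is at most `32 L²`. Switching the lamp at `b` as seen from `y`
(go to `b`, switch, return) therefore moves `f` by `O(L²)` in mean square, although `b` may be far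
away. Enflo type 2 (`sum_norm_sq_sub_prod_le`) then bounds the mean square displacement under
switching all `n` lamps by `O(n L²)`. But a generator changes at most one lamp
(`lampCount_le_wordLength`), so the word distance between such pairs is at least `n`. Hence `n² ≤
O(n) (L M)²`, where `M` is the expansion of the inverse.

A random `S` has the gap with probability at least `1 - 1/n` (`card_mul_card_filter_not_gap_le`):
for each nontrivial character, at most half of the group has values near `1`, an exponential moment
bounds by `n⁻²` the probability that three quarters of `S` lies there, and a union bound over the
`n` characters finishes. A nonempty set with the gap generates, so conditioning on generation costs
nothing. -/

/-! ### Characters, spectral gap and the Poincaré inequality. -/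

section Fourier

variable {G : Type*} [AddCommGroup G] [Fintype G]
variable {E : Type*} [NormedAddCommGroup E] [InnerProductSpace ℂ E]

/-- Parseval's identity for vector-valued functions on a finite abelian group. -/
theorem sum_norm_sq_fourier (h : G → E) :
    ∑ ψ : AddChar G ℂ, ‖∑ x, ψ x • h x‖ ^ 2 = Fintype.card G * ∑ x, ‖h x‖ ^ 2 := by
  classical
  have key : ∑ ψ : AddChar G ℂ, inner ℂ (∑ x, ψ x • h x) (∑ x, ψ x • h x)
      = Fintype.card G * ∑ x, inner ℂ (h x) (h x) := by
    have h1 (ψ : AddChar G ℂ) : inner ℂ (∑ x, ψ x • h x) (∑ x, ψ x • h x)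
        = ∑ x, ∑ y, ψ (y - x) * inner ℂ (h x) (h y) := by
      rw [sum_inner]
      refine Finset.sum_congr rfl fun x _ => ?_
      rw [inner_sum]
      refine Finset.sum_congr rfl fun y _ => ?_
      rw [inner_smul_left, inner_smul_right, sub_eq_add_neg, AddChar.map_add_eq_mul,
        AddChar.map_neg_eq_conj]
      ring
    simp_rw [h1]
    rw [Finset.sum_comm, Finset.mul_sum]
    refine Finset.sum_congr rfl fun x _ => ?_
    rw [Finset.sum_comm]
    simp_rw [← Finset.sum_mul, AddChar.sum_apply_eq_ite, sub_eq_zero]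
    simp
  simp only [inner_self_eq_norm_sq_to_K] at key
  refine Complex.ofReal_injective ?_
  push_cast
  exact key

/-- Parseval for `g` minus its translate: translation by `t` multiplies each Fourier coefficient by
`ψ (-t)`. -/
theorem sum_norm_sq_sub_translate (g : G → E) (t : G) :
    Fintype.card G * ∑ x, ‖g x - g (x + t)‖ ^ 2
      = ∑ ψ : AddChar G ℂ, ‖1 - ψ t‖ ^ 2 * ‖∑ x, ψ x • g x‖ ^ 2 := by
  rw [← sum_norm_sq_fourier (fun x => g x - g (x + t))]
  refine Finset.sum_congr rfl fun ψ _ => ?_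
  have h1 : ∑ x, ψ x • g (x + t) = ψ (-t) • ∑ x, ψ x • g x := by
    rw [Finset.smul_sum, ← Equiv.sum_comp (Equiv.addRight t) (fun x => ψ (-t) • ψ x • g x)]
    refine Finset.sum_congr rfl fun x _ => ?_
    rw [smul_smul, ← AddChar.map_add_eq_mul]
    simp
  have h2 : ∑ x, ψ x • (g x - g (x + t)) = (1 - ψ (-t)) • ∑ x, ψ x • g x := by
    simp_rw [smul_sub, Finset.sum_sub_distrib, h1, sub_smul, one_smul]
  have h3 : ‖1 - ψ (-t)‖ = ‖1 - ψ t‖ := by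
    rw [AddChar.map_neg_eq_conj, ← Complex.norm_conj (1 - ψ t)]
    simp
  rw [h2, norm_smul, mul_pow, h3]

/-- A spectral gap for the finite set `S`: on average over `S`, every nontrivial character is
bounded away from `1`. -/
def HasCharacterGap (S : Finset G) : Prop :=
  ∀ ψ : AddChar G ℂ, ψ ≠ 0 → (S.card : ℝ) / 8 ≤ ∑ s ∈ S, ‖1 - ψ s‖ ^ 2

/-- The Poincaré inequality for a set with a spectral gap. -/
theorem HasCharacterGap.poincare {S : Finset G} (hS : HasCharacterGap S) (g : G → E) :
    S.card * ∑ t, ∑ x, ‖g x - g (x + t)‖ ^ 2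
      ≤ 32 * Fintype.card G * ∑ s ∈ S, ∑ x, ‖g x - g (x + s)‖ ^ 2 := by
  have hcard : (0 : ℝ) < Fintype.card G := by exact_mod_cast Fintype.card_pos
  refine le_of_mul_le_mul_left ?_ hcard
  have hL : (Fintype.card G : ℝ) * (S.card * ∑ t, ∑ x, ‖g x - g (x + t)‖ ^ 2)
      = ∑ ψ : AddChar G ℂ, S.card * (∑ t, ‖1 - ψ t‖ ^ 2) * ‖∑ x, ψ x • g x‖ ^ 2 := by
    rw [mul_left_comm, Finset.mul_sum]
    simp_rw [sum_norm_sq_sub_translate]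
    rw [Finset.sum_comm, Finset.mul_sum]
    simp_rw [← Finset.sum_mul, mul_assoc]
  have hR : (Fintype.card G : ℝ) * (32 * Fintype.card G * ∑ s ∈ S, ∑ x, ‖g x - g (x + s)‖ ^ 2)
      = ∑ ψ : AddChar G ℂ, 32 * Fintype.card G * (∑ s ∈ S, ‖1 - ψ s‖ ^ 2)
        * ‖∑ x, ψ x • g x‖ ^ 2 := by
    rw [mul_left_comm, Finset.mul_sum]
    simp_rw [sum_norm_sq_sub_translate]
    rw [Finset.sum_comm, Finset.mul_sum]
    simp_rw [← Finset.sum_mul, mul_assoc]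
  rw [hL, hR]
  refine Finset.sum_le_sum fun ψ _ => mul_le_mul_of_nonneg_right ?_ (by positivity)
  by_cases hψ : ψ = 0
  · simp [hψ]
  -- The comparison is made character by character; `32` is the trivial bound `4` divided by the gap
  -- `1/8`.
  have h4 : ∑ t, ‖1 - ψ t‖ ^ 2 ≤ Fintype.card G * 4 := by
    rw [← nsmul_eq_mul]
    refine Finset.sum_le_card_nsmul _ _ _ fun t _ => ?_
    have h5 : ‖1 - ψ t‖ ≤ 2 := (norm_sub_le _ _).trans (by norm_num [AddChar.norm_apply])
    nlinarith [norm_nonneg (1 - ψ t)]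
  have h6 := hS ψ hψ
  calc (S.card : ℝ) * ∑ t, ‖1 - ψ t‖ ^ 2 ≤ S.card * (Fintype.card G * 4) := by gcongr
    _ = 32 * Fintype.card G * (S.card / 8) := by ring
    _ ≤ _ := by gcongr

/-- A set with a spectral gap generates the group. -/
theorem HasCharacterGap.closure_eq_top {S : Finset G} (hS : HasCharacterGap S)
    (hne : S.Nonempty) : AddSubgroup.closure (S : Set G) = ⊤ := by
  classical
  set H := AddSubgroup.closure (S : Set G)
  -- The indicator of `H` is invariant under `S`, so the Poincaré inequality makes it constant.
  let g : G → ℂ := fun x => if x ∈ H then 1 else 0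
  have h := hS.poincare g
  have h0 : ∑ s ∈ S, ∑ x, ‖g x - g (x + s)‖ ^ 2 = 0 := by
    refine Finset.sum_eq_zero fun s hs => Finset.sum_eq_zero fun x _ => ?_
    have : x + s ∈ H ↔ x ∈ H := H.add_mem_cancel_right (AddSubgroup.subset_closure hs)
    simp [g, this]
  rw [h0, mul_zero] at h
  have hc : (0 : ℝ) < S.card := by exact_mod_cast hne.card_pos
  have h1 : ∑ t, ∑ x, ‖g x - g (x + t)‖ ^ 2 = 0 :=
    le_antisymm (nonpos_of_mul_nonpos_right h hc) (by positivity)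
  rw [eq_top_iff]
  intro t _
  rw [Finset.sum_eq_zero_iff_of_nonneg (fun _ _ => by positivity)] at h1
  have h2 := h1 t (Finset.mem_univ t)
  rw [Finset.sum_eq_zero_iff_of_nonneg (fun _ _ => by positivity)] at h2
  have h3 := h2 0 (Finset.mem_univ 0)
  by_contra ht
  simp [g, H.zero_mem, ht] at h3

/-- A nontrivial character takes values close to `1` at most half of the time. -/
theorem two_mul_card_near_one_le {ψ : AddChar G ℂ} (hψ : ψ ≠ 0) :
    2 * (Finset.univ.filter fun t => ‖1 - ψ t‖ ^ 2 < 1 / 2).card ≤ Fintype.card G := by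
  classical
  set B := Finset.univ.filter fun t => ‖1 - ψ t‖ ^ 2 < 1 / 2
  -- The values of `ψ` sum to zero, so some `t₀` has `‖1 - ψ t₀‖ ≥ √2`. A common point of `B` and `B
  -- + t₀` would force `‖1 - ψ t₀‖ < 2 / √2`, so these two sets of equal size are disjoint.
  obtain ⟨t₀, ht₀⟩ : ∃ t, (ψ t).re ≤ 0 := by
    by_contra! hcon
    have h1 : ∑ t, ψ t = 0 := AddChar.sum_eq_zero_iff_ne_zero.2 hψ
    have h2 : ∑ t, (ψ t).re = 0 := by rw [← Complex.re_sum, h1, Complex.zero_re]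
    exact (Finset.sum_pos (fun t _ => hcon t) Finset.univ_nonempty).ne' h2
  have hdist : 2 ≤ ‖1 - ψ t₀‖ ^ 2 := by
    have h1 : ‖ψ t₀‖ ^ 2 = 1 := by simp [AddChar.norm_apply]
    rw [← Complex.normSq_eq_norm_sq, Complex.normSq_apply] at h1 ⊢
    simp only [Complex.sub_re, Complex.sub_im, Complex.one_re, Complex.one_im]
    nlinarith
  have hdisj : Disjoint B (B.map (addRightEmbedding t₀)) := by
    rw [Finset.disjoint_left]
    intro a ha hb
    simp only [Finset.mem_map, addRightEmbedding_apply] at hb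
    obtain ⟨b, hb, rfl⟩ := hb
    simp only [B, Finset.mem_filter, Finset.mem_univ, true_and] at ha hb
    have h1 : ‖1 - ψ t₀‖ ≤ ‖1 - ψ (b + t₀)‖ + ‖1 - ψ b‖ := by
      have h2 : ‖1 - ψ t₀‖ = ‖ψ b - ψ (b + t₀)‖ := by
        rw [AddChar.map_add_eq_mul]
        have : ψ b - ψ b * ψ t₀ = ψ b * (1 - ψ t₀) := by ring
        rw [this, norm_mul, AddChar.norm_apply, one_mul]
      rw [h2]
      calc _ = ‖(1 - ψ (b + t₀)) - (1 - ψ b)‖ := by congr 1; ring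
        _ ≤ _ := norm_sub_le _ _
    nlinarith [norm_nonneg (1 - ψ t₀), sq_nonneg (‖1 - ψ (b + t₀)‖ - ‖1 - ψ b‖)]
  have := Finset.card_le_univ (B.disjUnion _ hdisj)
  rw [Finset.card_disjUnion, Finset.card_map] at this
  omega

end Fourier

/-! ### Exponential moments for random subsets of fixed size. -/

section Concentration

theorem two_pow_mul_choose_le {b n : ℕ} (h : 2 * b ≤ n) (j : ℕ) :
    2 ^ j * b.choose j ≤ n.choose j := by
  have h1 : 2 ^ j * b.descFactorial j ≤ n.descFactorial j := by
    induction j with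
    | zero => simp
    | succ j ih =>
      rw [Nat.descFactorial_succ, Nat.descFactorial_succ, pow_succ]
      calc 2 ^ j * 2 * ((b - j) * b.descFactorial j)
          = (2 * (b - j)) * (2 ^ j * b.descFactorial j) := by ring
        _ ≤ (n - j) * n.descFactorial j := Nat.mul_le_mul (by omega) ih
  rw [Nat.descFactorial_eq_factorial_mul_choose, Nat.descFactorial_eq_factorial_mul_choose,
    mul_left_comm] at h1
  exact Nat.le_of_mul_le_mul_left h1 j.factorial_pos

variable {α : Type*} [Fintype α] [DecidableEq α]

/-- The exponential moment of the number of elements that a random `k`-element set has in a set of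
density at most `1/2` is at most that of the binomial distribution. -/
theorem sum_two_pow_card_inter_le (B : Finset α) (hB : 2 * B.card ≤ Fintype.card α) (k : ℕ) :
    ∑ S ∈ Finset.univ.powersetCard k, (2 : ℝ) ^ (S ∩ B).card
      ≤ (3 / 2) ^ k * (Fintype.card α).choose k := by
  set n := Fintype.card α
  have h1 : ∑ S ∈ Finset.univ.powersetCard k, (2 : ℝ) ^ (S ∩ B).card
      = ∑ T ∈ B.powerset, (((Finset.univ.powersetCard k).filter fun S => T ⊆ S).card : ℝ) := by
    -- `2 ^ |S ∩ B|` counts the subsets `T` of `S ∩ B`; exchanging sums leaves the number of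
    -- `k`-sets containing a given `T`.
    have h2 (S : Finset α) :
        (2 : ℝ) ^ (S ∩ B).card = ∑ T ∈ B.powerset, if T ⊆ S then 1 else 0 := by
      rw [Finset.sum_boole]
      have : B.powerset.filter (fun T => T ⊆ S) = (S ∩ B).powerset := by
        ext T
        rw [Finset.mem_filter, Finset.mem_powerset, Finset.mem_powerset, Finset.subset_inter_iff,
          and_comm]
      rw [this, Finset.card_powerset]
      push_cast
      rfl
    simp_rw [h2]
    rw [Finset.sum_comm]
    simp_rw [Finset.sum_boole]
  have h3 : ∀ T ∈ B.powerset,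
      (((Finset.univ.powersetCard k).filter fun S => T ⊆ S).card : ℝ)
        = if T.card ≤ k then ((n - T.card).choose (k - T.card) : ℝ) else 0 := by
    intro T _
    split_ifs with h
    · rw [Finset.card_filter_powersetCard_subset _ _ _ (Finset.subset_univ T) h, Finset.card_univ]
    · rw [Nat.cast_eq_zero, Finset.card_eq_zero, Finset.filter_eq_empty_iff]
      intro S hS hTS
      rw [Finset.mem_powersetCard] at hS
      exact h (hS.2 ▸ Finset.card_le_card hTS)
  rw [h1, Finset.sum_congr rfl h3,
    Finset.sum_powerset_apply_card
      (fun j => if j ≤ k then ((n - j).choose (k - j) : ℝ) else 0)]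
  simp_rw [nsmul_eq_mul]
  have h5 : ∀ j, ((B.card.choose j : ℝ) * if j ≤ k then ((n - j).choose (k - j) : ℝ) else 0)
      ≤ if j ≤ k then (k.choose j : ℝ) * (1 / 2) ^ j * n.choose k else 0 := by
    intro j
    split_ifs with hj
    · have h6 : (n.choose k : ℝ) * k.choose j = n.choose j * (n - j).choose (k - j) := by
        exact_mod_cast Nat.choose_mul hj
      have h7 : (2 : ℝ) ^ j * B.card.choose j ≤ n.choose j := by
        exact_mod_cast two_pow_mul_choose_le hB j
      calc (B.card.choose j : ℝ) * (n - j).choose (k - j)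
          = (1 / 2) ^ j * (2 ^ j * B.card.choose j * (n - j).choose (k - j)) := by
            rw [div_pow, one_pow]; field_simp
        _ ≤ (1 / 2) ^ j * (n.choose j * (n - j).choose (k - j)) := by gcongr
        _ = _ := by rw [← h6]; ring
    · simp
  calc _ ≤ ∑ j ∈ Finset.range (B.card + 1),
        if j ≤ k then (k.choose j : ℝ) * (1 / 2) ^ j * n.choose k else 0 :=
        Finset.sum_le_sum fun j _ => h5 j
    _ = ∑ j ∈ (Finset.range (B.card + 1)).filter (· ≤ k),
        (k.choose j : ℝ) * (1 / 2) ^ j * n.choose k := (Finset.sum_filter _ _).symm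
    _ ≤ ∑ j ∈ Finset.range (k + 1), (k.choose j : ℝ) * (1 / 2) ^ j * n.choose k := by
        refine Finset.sum_le_sum_of_subset_of_nonneg (fun j hj => ?_) fun _ _ _ => by positivity
        simp only [Finset.mem_filter, Finset.mem_range] at hj ⊢
        omega
    _ = (3 / 2) ^ k * n.choose k := by
        rw [← Finset.sum_mul]
        congr 1
        have := add_pow (1 / 2 : ℝ) 1 k
        norm_num at this ⊢
        rw [this]
        exact Finset.sum_congr rfl fun j _ => by ring

end Concentration

/-! ### Enflo type 2 for Hilbert spaces. -/

section Cube

/-- The right side minus the left side is exactly `‖a - b + c - d‖ ^ 2`. -/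
theorem sum_sq_diagonals_le_sum_sq_sides {E : Type*} [NormedAddCommGroup E]
    [InnerProductSpace ℝ E] (a b c d : E) :
    ‖a - c‖ ^ 2 + ‖b - d‖ ^ 2 ≤ ‖a - b‖ ^ 2 + ‖b - c‖ ^ 2 + ‖c - d‖ ^ 2 + ‖d - a‖ ^ 2 := by
  have h : 0 ≤ ‖a - b + c - d‖ ^ 2 := by positivity
  simp only [← real_inner_self_eq_norm_sq, inner_sub_left, inner_sub_right, inner_add_left,
    inner_add_right] at h ⊢
  rw [real_inner_comm a b, real_inner_comm a c, real_inner_comm a d, real_inner_comm b c,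
    real_inner_comm b d, real_inner_comm c d] at *
  linarith

variable {V : Type*} [CommGroup V] [Fintype V]
variable {E : Type*} [NormedAddCommGroup E] [InnerProductSpace ℝ E]

/-- The quadrilateral inequality is summed over the vertices `A`, `A g`, `A g h`, `A h`. Since `g² =
1`, the diagonal from `A g` to `A h` is again a step by `g h`; opposite sides also agree in sum, and
the factor 2 cancels. -/
theorem sum_norm_sq_sub_mul_le (F : V → E) {g : V} (hg : g * g = 1) (h : V) :
    ∑ A, ‖F A - F (A * (g * h))‖ ^ 2
      ≤ ∑ A, ‖F A - F (A * g)‖ ^ 2 + ∑ A, ‖F A - F (A * h)‖ ^ 2 := by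
  have key := Finset.sum_le_sum fun A (_ : A ∈ (Finset.univ : Finset V)) =>
    sum_sq_diagonals_le_sum_sq_sides (F A) (F (A * g)) (F (A * g * h)) (F (A * h))
  simp only [Finset.sum_add_distrib] at key
  have h1 : ∑ A, ‖F (A * g) - F (A * h)‖ ^ 2 = ∑ A, ‖F A - F (A * (g * h))‖ ^ 2 := by
    rw [← Equiv.sum_comp (Equiv.mulRight g) fun A => ‖F A - F (A * (g * h))‖ ^ 2]
    refine Finset.sum_congr rfl fun A _ => ?_
    rw [Equiv.coe_mulRight, ← mul_assoc (A * g), mul_assoc A g g, hg, mul_one]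
  have h2 : ∑ A, ‖F (A * g) - F (A * g * h)‖ ^ 2 = ∑ A, ‖F A - F (A * h)‖ ^ 2 :=
    Equiv.sum_comp (Equiv.mulRight g) fun A => ‖F A - F (A * h)‖ ^ 2
  have h3 : ∑ A, ‖F (A * g * h) - F (A * h)‖ ^ 2 = ∑ A, ‖F A - F (A * g)‖ ^ 2 := by
    rw [← Equiv.sum_comp (Equiv.mulRight h) fun A => ‖F A - F (A * g)‖ ^ 2]
    refine Finset.sum_congr rfl fun A _ => ?_
    rw [Equiv.coe_mulRight, norm_sub_rev, mul_right_comm]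
  have h4 : ∑ A, ‖F (A * h) - F A‖ ^ 2 = ∑ A, ‖F A - F (A * h)‖ ^ 2 := by
    simp_rw [norm_sub_rev]
  rw [h1, h2, h3, h4] at key
  simp only [mul_assoc] at key ⊢
  linarith

/-- Hilbert spaces have Enflo type 2. -/
theorem sum_norm_sq_sub_prod_le {ι : Type*} (F : V → E) (g : ι → V) (hg : ∀ i, g i * g i = 1)
    (s : Finset ι) :
    ∑ A, ‖F A - F (A * ∏ i ∈ s, g i)‖ ^ 2 ≤ ∑ i ∈ s, ∑ A, ‖F A - F (A * g i)‖ ^ 2 := by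
  classical
  induction s using Finset.induction_on with
  | empty => simp
  | insert i s hi ih =>
    rw [Finset.prod_insert hi, Finset.sum_insert hi]
    exact (sum_norm_sq_sub_mul_le F (hg i) _).trans (by linarith)

end Cube

/-! ### Counting lamps: the lower bound for the word metric. -/

section Lamps

variable {D Q : Type*} [Group D] [Group Q] [Fintype Q] [DecidableEq D]

/-- The number of lamps that an element of a wreath product changes. -/
def lampCount (g : RegularWreathProduct D Q) : ℕ := (Finset.univ.filter fun i => g.left i ≠ 1).card

/-- The changed lamps of the product lie among those of `a` and the translate by `a.right` of those
of `b`. -/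
theorem lampCount_mul_le (a b : RegularWreathProduct D Q) :
    lampCount (a * b) ≤ lampCount a + lampCount b := by
  classical
  have h : (Finset.univ.filter fun i => (a * b).left i ≠ 1)
      ⊆ (Finset.univ.filter fun i => a.left i ≠ 1)
        ∪ (Finset.univ.filter fun i => b.left i ≠ 1).image (a.right * ·) := by
    intro i hi
    simp only [Finset.mem_filter, Finset.mem_univ, true_and, Finset.mem_union,
      Finset.mem_image] at hi ⊢
    by_contra! hcon
    refine hi ?_
    have h2 : b.left (a.right⁻¹ * i) = 1 := by
      by_contra hne
      exact hcon.2 _ hne (by simp)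
    simp [hcon.1, h2]
  exact (Finset.card_le_card h).trans
    ((Finset.card_union_le _ _).trans (Nat.add_le_add_left Finset.card_image_le _))

theorem lampCount_inv_le (a : RegularWreathProduct D Q) : lampCount a⁻¹ ≤ lampCount a := by
  refine Finset.card_le_card_of_injOn (a.right * ·) (fun i hi => ?_)
    (fun i _ j _ hij => mul_left_cancel hij)
  simpa using hi

theorem lampCount_prod_le {T : Set (RegularWreathProduct D Q)} (hT : ∀ g ∈ T, lampCount g ≤ 1)
    {l : List (RegularWreathProduct D Q)} (hl : IsWordIn T l) : lampCount l.prod ≤ l.length := by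
  induction l with
  | nil => simp [lampCount]
  | cons a l ih =>
    rw [List.prod_cons, List.length_cons, add_comm]
    refine (lampCount_mul_le _ _).trans (add_le_add ?_ (ih fun b hb => hl b (by simp [hb])))
    rcases hl a (by simp) with h | h
    · exact hT a h
    · simpa using (lampCount_inv_le a⁻¹).trans (hT _ h)

theorem lampCount_le_wordLength {T : Set (RegularWreathProduct D Q)}
    (hT : ∀ g ∈ T, lampCount g ≤ 1) (g : RegularWreathProduct D Q) :
    (lampCount g : ℝ≥0∞) ≤ wordLength T g := by
  refine le_iInf fun l => le_iInf fun hl => le_iInf fun hg => ?_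
  rw [← hg]
  exact_mod_cast lampCount_prod_le hT hl

theorem lampCount_inv_mul_eq {x z : RegularWreathProduct D Q} (h : ∀ i, x.left i ≠ z.left i) :
    lampCount (x⁻¹ * z) = Fintype.card Q := by
  rw [lampCount, Finset.filter_true_of_mem, Finset.card_univ]
  intro i _
  simpa [inv_mul_eq_one] using h _

theorem lampCount_le_one_of_mem {n : ℕ} [NeZero n] {S : Finset (CyclicGrp n)} {g : Lamplighter n}
    (hg : g ∈ lamplighterGenerators S) : lampCount g ≤ 1 := by
  rcases hg with ⟨h, -⟩ | h
  · simp [lampCount, h]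
  · rw [Set.mem_singleton_iff] at h
    subst h
    refine Finset.card_le_one.2 ?_
    have hi : ∀ i : CyclicGrp n, (Pi.mulSingle 1 (Multiplicative.ofAdd 1) :
        CyclicGrp n → CyclicGrp 2) i ≠ 1 → i = 1 := fun i hi => by
      by_contra hne
      exact hi (Pi.mulSingle_eq_of_ne hne _)
    intro i h1 j h2
    simp only [Finset.mem_filter, Finset.mem_univ, true_and] at h1 h2
    rw [hi i h1, hi j h2]

end Lamps

/-! ### The distortion bound for a set with a spectral gap. -/

section Distortion

variable {n : ℕ}

/-- The element of the lamp group that switches the lamp at `b`. -/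
def lampSwitch (b : CyclicGrp n) : CyclicGrp n → CyclicGrp 2 :=
  Pi.mulSingle b (Multiplicative.ofAdd 1)

theorem lampSwitch_mul_self (b : CyclicGrp n) : lampSwitch b * lampSwitch b = 1 := by
  rw [lampSwitch, ← Pi.mulSingle_mul]
  exact Pi.mulSingle_one b

theorem prod_lampSwitch [NeZero n] : ∏ b : CyclicGrp n, lampSwitch b = fun _ => Multiplicative.ofAdd 1 :=
  Finset.univ_prod_mulSingle (fun _ : CyclicGrp n => (Multiplicative.ofAdd 1 : CyclicGrp 2))

theorem mk_mul_lampSwitch (A : CyclicGrp n → CyclicGrp 2) (b : CyclicGrp n) :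
    (⟨A, b⟩ * ⟨Pi.mulSingle 1 (Multiplicative.ofAdd 1), 1⟩ : Lamplighter n)
      = ⟨A * lampSwitch b, b⟩ := by
  refine RegularWreathProduct.ext ?_ (by simp)
  funext i
  simp only [RegularWreathProduct.mul_left, Pi.mul_apply, lampSwitch, Pi.mulSingle_apply,
    inv_mul_eq_one, eq_comm]

variable [NeZero n] {E : Type*} [NormedAddCommGroup E] [InnerProductSpace ℂ E]

theorem sum_norm_sq_positions_le {S : Finset (CyclicGrp n)} (hne : S.Nonempty)
    (hS : HasCharacterGap (G := ZMod n) S) {f : Lamplighter n → E} {L : ℝ}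
    (hL : ∀ x, ∀ s ∈ lamplighterGenerators S, ‖f x - f (x * s)‖ ≤ L)
    (A : CyclicGrp n → CyclicGrp 2) :
    ∑ b, ∑ y, ‖f ⟨A, y⟩ - f ⟨A, b⟩‖ ^ 2 ≤ 32 * n ^ 2 * L ^ 2 := by
  -- The same set in additive notation; the two types agree definitionally.
  let S' : Finset (ZMod n) := S
  have hc : (0 : ℝ) < S'.card := Nat.cast_pos.2 (Finset.card_pos.2 hne)
  let g : ZMod n → E := fun x => f ⟨A, Multiplicative.ofAdd x⟩
  have h := HasCharacterGap.poincare (S := S') hS g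
  have h1 : ∑ t, ∑ x, ‖g x - g (x + t)‖ ^ 2
      = ∑ b : CyclicGrp n, ∑ y, ‖f ⟨A, y⟩ - f ⟨A, b⟩‖ ^ 2 := by
    rw [Finset.sum_comm, Finset.sum_comm (f := fun b y => ‖f ⟨A, y⟩ - f ⟨A, b⟩‖ ^ 2)]
    rw [← Equiv.sum_comp Multiplicative.ofAdd]
    exact Finset.sum_congr rfl fun x _ => Equiv.sum_comp
      ((Equiv.addLeft x).trans Multiplicative.ofAdd) fun b => ‖g x - f ⟨A, b⟩‖ ^ 2
  have h2 : ∑ s ∈ S', ∑ x, ‖g x - g (x + s)‖ ^ 2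
      ≤ S'.card * (n * L ^ 2) := by
    rw [← nsmul_eq_mul]
    refine Finset.sum_le_card_nsmul _ _ _ fun s hs => ?_
    have : (n : ℝ) * L ^ 2 = (Finset.univ : Finset (ZMod n)).card • L ^ 2 := by
      rw [Finset.card_univ, ZMod.card, nsmul_eq_mul]
    rw [this]
    refine Finset.sum_le_card_nsmul _ _ _ fun x _ => ?_
    have h3 := hL ⟨A, Multiplicative.ofAdd x⟩ ⟨1, Multiplicative.ofAdd s⟩ (Or.inl ⟨rfl, hs⟩)
    have h4 : (⟨A, Multiplicative.ofAdd x⟩ * ⟨1, Multiplicative.ofAdd s⟩ : Lamplighter n)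
        = ⟨A, Multiplicative.ofAdd (x + s)⟩ := by
      refine RegularWreathProduct.ext ?_ rfl
      funext i
      simp
    rw [h4] at h3
    gcongr
  rw [h1, ZMod.card] at h
  refine le_of_mul_le_mul_left (h.trans ?_) hc
  calc _ ≤ 32 * (n : ℝ) * (S'.card * (n * L ^ 2)) := by gcongr
    _ = _ := by ring

/-- The path from `y` to `b`, the switch at `b` and the way back give `195 = 3 * (32 + 1 + 32)`, the
`3` coming from squaring a sum of three terms. -/
theorem sum_norm_sq_switch_le {S : Finset (CyclicGrp n)} (hne : S.Nonempty)
    (hS : HasCharacterGap (G := ZMod n) S) {f : Lamplighter n → E} {L : ℝ}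
    (hL : ∀ x, ∀ s ∈ lamplighterGenerators S, ‖f x - f (x * s)‖ ≤ L) :
    ∑ b, ∑ A, ∑ y, ‖f ⟨A, y⟩ - f ⟨A * lampSwitch b, y⟩‖ ^ 2
      ≤ Fintype.card (CyclicGrp n → CyclicGrp 2) * (195 * n ^ 2 * L ^ 2) := by
  have hpt (b : CyclicGrp n) (A : CyclicGrp n → CyclicGrp 2) (y : CyclicGrp n) :
      ‖f ⟨A, y⟩ - f ⟨A * lampSwitch b, y⟩‖ ^ 2
        ≤ 3 * (‖f ⟨A, y⟩ - f ⟨A, b⟩‖ ^ 2 + L ^ 2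
          + ‖f ⟨A * lampSwitch b, y⟩ - f ⟨A * lampSwitch b, b⟩‖ ^ 2) := by
    have h1 := hL ⟨A, b⟩ _ (Or.inr rfl)
    rw [mk_mul_lampSwitch] at h1
    have h2 : ‖f ⟨A, y⟩ - f ⟨A * lampSwitch b, y⟩‖ ≤ ‖f ⟨A, y⟩ - f ⟨A, b⟩‖ + L
        + ‖f ⟨A * lampSwitch b, y⟩ - f ⟨A * lampSwitch b, b⟩‖ := by
      have h3 := dist_triangle4 (f ⟨A, y⟩) (f ⟨A, b⟩) (f ⟨A * lampSwitch b, b⟩)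
        (f ⟨A * lampSwitch b, y⟩)
      rw [dist_comm (f ⟨A * lampSwitch b, b⟩)] at h3
      simp only [dist_eq_norm] at h3
      linarith
    refine (pow_le_pow_left₀ (norm_nonneg _) h2 2).trans ?_
    set p := ‖f ⟨A, y⟩ - f ⟨A, b⟩‖
    set q := ‖f ⟨A * lampSwitch b, y⟩ - f ⟨A * lampSwitch b, b⟩‖
    nlinarith [sq_nonneg (p - L), sq_nonneg (p - q), sq_nonneg (L - q)]
  have h1 : ∑ b, ∑ A, ∑ y, ‖f ⟨A, y⟩ - f ⟨A, b⟩‖ ^ 2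
      ≤ Fintype.card (CyclicGrp n → CyclicGrp 2) * (32 * n ^ 2 * L ^ 2) := by
    rw [Finset.sum_comm, ← nsmul_eq_mul]
    exact Finset.sum_le_card_nsmul _ _ _ fun A _ => sum_norm_sq_positions_le hne hS hL A
  -- Switching lamp `b` permutes the configurations, so the way back costs the same in total as the
  -- way out.
  have h2 : ∑ b, ∑ A, ∑ y, ‖f ⟨A * lampSwitch b, y⟩ - f ⟨A * lampSwitch b, b⟩‖ ^ 2
      = ∑ b, ∑ A, ∑ y, ‖f ⟨A, y⟩ - f ⟨A, b⟩‖ ^ 2 :=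
    Finset.sum_congr rfl fun b _ => Equiv.sum_comp (Equiv.mulRight (lampSwitch b))
      fun A => ∑ y, ‖f ⟨A, y⟩ - f ⟨A, b⟩‖ ^ 2
  calc _ ≤ ∑ b, ∑ A, ∑ y, 3 * (‖f ⟨A, y⟩ - f ⟨A, b⟩‖ ^ 2 + L ^ 2
          + ‖f ⟨A * lampSwitch b, y⟩ - f ⟨A * lampSwitch b, b⟩‖ ^ 2) :=
        Finset.sum_le_sum fun b _ => Finset.sum_le_sum fun A _ => Finset.sum_le_sum fun y _ =>
          hpt b A y
    _ = 3 * (∑ b, ∑ A, ∑ y, ‖f ⟨A, y⟩ - f ⟨A, b⟩‖ ^ 2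
          + Fintype.card (CyclicGrp n → CyclicGrp 2) * (n ^ 2 * L ^ 2)
          + ∑ b, ∑ A, ∑ y, ‖f ⟨A * lampSwitch b, y⟩ - f ⟨A * lampSwitch b, b⟩‖ ^ 2) := by
        simp only [← Finset.mul_sum, Finset.sum_add_distrib]
        congr 3
        simp only [Finset.sum_const, Finset.card_univ, nsmul_eq_mul, Fintype.card_multiplicative,
          ZMod.card]
        ring
    _ ≤ _ := by
        rw [h2]
        linarith

/-- Two estimates of the mean square displacement under switching all lamps are compared: at least
`n² / M²` by `hM`, at most `195 n L²` by type 2. -/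
theorem card_le_sq_distortion {S : Finset (CyclicGrp n)} (hne : S.Nonempty)
    (hS : HasCharacterGap (G := ZMod n) S) {f : Lamplighter n → E} {L M : ℝ}
    (hL : ∀ x, ∀ s ∈ lamplighterGenerators S, ‖f x - f (x * s)‖ ≤ L)
    (hM : ∀ x z : Lamplighter n, (∀ i, x.left i ≠ z.left i) → n ≤ M * ‖f x - f z‖) :
    (n : ℝ) ≤ 195 * (L * M) ^ 2 := by
  let := InnerProductSpace.rclikeToReal ℂ E
  set N : ℝ := (Fintype.card (CyclicGrp n → CyclicGrp 2) : ℝ)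
  have hN : 0 < N := Nat.cast_pos.2 Fintype.card_pos
  have hn : (0 : ℝ) < n := by exact_mod_cast NeZero.pos n
  have hlow (A : CyclicGrp n → CyclicGrp 2) (y : CyclicGrp n) :
      (n : ℝ) ^ 2 ≤ M ^ 2 * ‖f ⟨A, y⟩ - f ⟨A * ∏ b, lampSwitch b, y⟩‖ ^ 2 := by
    rw [← mul_pow]
    refine pow_le_pow_left₀ hn.le (hM _ _ fun i => ?_) 2
    simp [prod_lampSwitch]
  have h1 : n * (N * n ^ 2)
      ≤ M ^ 2 * ∑ y, ∑ A, ‖f ⟨A, y⟩ - f ⟨A * ∏ b, lampSwitch b, y⟩‖ ^ 2 := by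
    calc n * (N * n ^ 2)
        = ∑ _y : CyclicGrp n, ∑ _A : CyclicGrp n → CyclicGrp 2, (n : ℝ) ^ 2 := by
          simp only [Finset.sum_const, Finset.card_univ, nsmul_eq_mul,
            Fintype.card_multiplicative, ZMod.card, N]
      _ ≤ _ := by
          simp only [Finset.mul_sum]
          exact Finset.sum_le_sum fun y _ => Finset.sum_le_sum fun A _ => hlow A y
  have h2 : ∑ y, ∑ A, ‖f ⟨A, y⟩ - f ⟨A * ∏ b, lampSwitch b, y⟩‖ ^ 2
      ≤ N * (195 * n ^ 2 * L ^ 2) := by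
    refine le_trans ?_ (sum_norm_sq_switch_le hne hS hL)
    calc _ ≤ ∑ y, ∑ b, ∑ A, ‖f ⟨A, y⟩ - f ⟨A * lampSwitch b, y⟩‖ ^ 2 :=
          Finset.sum_le_sum fun y _ => sum_norm_sq_sub_prod_le (fun A => f ⟨A, y⟩) lampSwitch
            lampSwitch_mul_self Finset.univ
      _ = _ := by
          rw [Finset.sum_comm]
          exact Finset.sum_congr rfl fun b _ => Finset.sum_comm
  have h3 : n * (N * n ^ 2) ≤ M ^ 2 * (N * (195 * n ^ 2 * L ^ 2)) := h1.trans (by gcongr)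
  refine le_of_mul_le_mul_left ?_ (show 0 < N * (n : ℝ) ^ 2 by positivity)
  linarith

theorem le_euclideanDistortion_of_gap {S : Finset (CyclicGrp n)} (hne : S.Nonempty)
    (hS : HasCharacterGap (G := ZMod n) S) :
    ENNReal.ofReal (1 / 14 * √(n : ℝ))
      ≤ euclideanDistortion (WordMetricSpace (lamplighterGenerators S)) := by
  refine le_iInf fun f => le_iInf fun hf => ?_
  obtain ⟨⟨K₁, hK₁⟩, K₂, hK₂⟩ := hf
  rw [mapDistortion]
  set L := ⨆ (x) (z) (_ : x ≠ z), edist (f x) (f z) / edist x z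
  set M := ⨆ (x) (z) (_ : x ≠ z), edist x z / edist (f x) (f z)
  have hLt : L ≠ ⊤ := ne_top_of_le_ne_top ENNReal.coe_ne_top <|
    iSup_le fun x => iSup_le fun z => iSup_le fun _ =>
      ENNReal.div_le_of_le_mul (hK₁ x z)
  have hMt : M ≠ ⊤ := ne_top_of_le_ne_top ENNReal.coe_ne_top <|
    iSup_le fun x => iSup_le fun z => iSup_le fun _ =>
      ENNReal.div_le_of_le_mul (hK₂ x z)
  have hword (x s : Lamplighter n) (hs : s ∈ lamplighterGenerators S) :
      edist (α := WordMetricSpace (lamplighterGenerators S)) x (x * s : Lamplighter n) ≤ 1 := by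
    change wordLength _ (x⁻¹ * (x * s)) ≤ 1
    have := wordLength_le (T := lamplighterGenerators S) (l := [s]) (by simp [IsWordIn, hs])
    simpa using this
  let f' : Lamplighter n → lp (fun _ : ℕ => ℂ) 2 := f
  have hfL (x s : Lamplighter n) (hs : s ∈ lamplighterGenerators S) :
      ‖f' x - f' (x * s)‖ ≤ L.toReal := by
    have h : edist (f' x) (f' (x * s)) ≤ L := by
      -- A trivial generator gives a pair that the supremum omits.
      by_cases hx : x = x * s
      · rw [← hx, edist_self]
        exact zero_le
      · have h1 : edist (f' x) (f' (x * s))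
            / edist (α := WordMetricSpace (lamplighterGenerators S)) x (x * s : Lamplighter n)
              ≤ L :=
          le_iSup_of_le (α := ℝ≥0∞) x (le_iSup_of_le (x * s : Lamplighter n)
            (le_iSup_of_le hx le_rfl))
        refine le_trans ?_ h1
        simpa using ENNReal.div_le_div_left (hword x s hs) (edist (f' x) (f' (x * s)))
    rw [← dist_eq_norm, ← ENNReal.ofReal_le_iff_le_toReal hLt, ← edist_dist]
    exact h
  have hfM (x z : Lamplighter n) (h : ∀ i, x.left i ≠ z.left i) :
      (n : ℝ) ≤ M.toReal * ‖f' x - f' z‖ := by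
    have hxz : x ≠ z := fun hxz => h 1 (by rw [hxz])
    have h1 : (n : ℝ≥0∞) ≤ edist (α := WordMetricSpace (lamplighterGenerators S)) x z := by
      have h2 := lampCount_le_wordLength (fun g => lampCount_le_one_of_mem (S := S)) (x⁻¹ * z)
      rwa [lampCount_inv_mul_eq h, Fintype.card_multiplicative, ZMod.card] at h2
    have h3 : edist (α := WordMetricSpace (lamplighterGenerators S)) x z
        / edist (f' x) (f' z) ≤ M :=
      le_iSup_of_le (α := ℝ≥0∞) x (le_iSup_of_le z (le_iSup_of_le hxz le_rfl))
    have h4 : edist (f' x) (f' z) ≠ 0 := by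
      exact fun h5 => hxz (hK₂.injective (edist_eq_zero.1 h5))
    have h6 : (n : ℝ≥0∞) ≤ M * edist (f' x) (f' z) :=
      h1.trans ((ENNReal.div_le_iff h4 (edist_ne_top _ _)).1 h3)
    have h7 := ENNReal.toReal_mono (ENNReal.mul_ne_top hMt (edist_ne_top _ _)) h6
    rwa [ENNReal.toReal_natCast, ENNReal.toReal_mul, ← dist_edist, dist_eq_norm] at h7
  have key := card_le_sq_distortion hne hS hfL hfM
  rw [← ENNReal.ofReal_toReal hLt, ← ENNReal.ofReal_toReal hMt,
    ← ENNReal.ofReal_mul ENNReal.toReal_nonneg]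
  refine ENNReal.ofReal_le_ofReal ?_
  set P := L.toReal * M.toReal
  have hP : 0 ≤ P := mul_nonneg ENNReal.toReal_nonneg ENNReal.toReal_nonneg
  -- `195 ≤ 14²`, whence the constant `1 / 14`.
  have : √(n : ℝ) ≤ 14 * P := Real.sqrt_le_iff.2 ⟨by positivity, by nlinarith [sq_nonneg P]⟩
  linarith

end Distortion

/-! ### Random subsets have a spectral gap. -/

section RandomSubset

variable {G : Type*} [AddCommGroup G] [Fintype G]

/-- Each element of `S` outside the near-one set contributes at least `1/2`, so fewer than a quarter
of them lie outside. -/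
theorem three_mul_card_le_of_sum_lt [DecidableEq G] {S : Finset G} {ψ : AddChar G ℂ}
    (h : ∑ s ∈ S, ‖1 - ψ s‖ ^ 2 < (S.card : ℝ) / 8) :
    3 * S.card ≤ 4 * (S ∩ Finset.univ.filter fun t => ‖1 - ψ t‖ ^ 2 < 1 / 2).card := by
  set B := Finset.univ.filter fun t => ‖1 - ψ t‖ ^ 2 < 1 / 2
  have h1 : ((S \ B).card : ℝ) * (1 / 2) ≤ ∑ s ∈ S, ‖1 - ψ s‖ ^ 2 := by
    rw [← nsmul_eq_mul]
    refine (Finset.card_nsmul_le_sum _ (fun s => ‖1 - ψ s‖ ^ 2) _ fun s hs => ?_).trans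
      (Finset.sum_le_sum_of_subset_of_nonneg Finset.sdiff_subset fun _ _ _ => by positivity)
    simpa [B] using (Finset.mem_sdiff.1 hs).2
  have h2 : (4 * (S \ B).card : ℝ) < S.card := by linarith
  have h3 : 4 * (S \ B).card < S.card := by exact_mod_cast h2
  have h4 := Finset.card_inter_add_card_sdiff S B
  omega

/-- This is where `100` enters: `(3/4) log 2 - log (3/2) ≥ 0.02`, and `0.02 k ≥ 2 log n`. -/
theorem sq_mul_three_halves_pow_le {n k : ℕ} (hn : 0 < n) (hk : 100 * Real.log n ≤ k) :
    (n : ℝ) ^ 2 * (3 / 2) ^ k ≤ 2 ^ (3 / 4 * k : ℝ) := by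
  have hn' : (0 : ℝ) < n := by exact_mod_cast hn
  rw [← Real.log_le_log_iff (by positivity) (by positivity), Real.log_mul (by positivity)
    (by positivity), Real.log_pow, Real.log_pow, Real.log_rpow two_pos]
  have h1 : 1 - (128 / 81 : ℝ)⁻¹ ≤ Real.log (128 / 81) :=
    Real.one_sub_inv_le_log_of_pos (by norm_num)
  have h2 : Real.log (128 / 81) = 3 * Real.log 2 - 4 * Real.log (3 / 2) := by
    rw [show (128 / 81 : ℝ) = 2 ^ 3 / (3 / 2) ^ 4 by norm_num, Real.log_div (by norm_num)
      (by norm_num), Real.log_pow, Real.log_pow]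
    norm_num
  have hk0 : (0 : ℝ) ≤ k := Nat.cast_nonneg k
  have h3 : (k : ℝ) * (0.08 + 4 * Real.log (3 / 2)) ≤ k * (3 * Real.log 2) :=
    mul_le_mul_of_nonneg_left (by norm_num at h1; linarith) hk0
  push_cast
  linarith

open scoped Classical in
/-- A random set of at least logarithmic size is unlikely to lack a spectral gap. -/
theorem card_mul_card_filter_not_gap_le {k : ℕ} (hk : 100 * Real.log (Fintype.card G) ≤ k) :
    Fintype.card G * ((Finset.univ.powersetCard k).filter
      fun S : Finset G => ¬ HasCharacterGap S).card ≤ (Fintype.card G).choose k := by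
  set n := Fintype.card G
  have hn : 0 < n := Fintype.card_pos
  let bad (ψ : AddChar G ℂ) : Finset (Finset G) :=
    (Finset.univ.powersetCard k).filter
      fun S => ψ ≠ 0 ∧ ∑ s ∈ S, ‖1 - ψ s‖ ^ 2 < (S.card : ℝ) / 8
  have hbad (ψ : AddChar G ℂ) : n ^ 2 * (bad ψ).card ≤ n.choose k := by
    by_cases hψ : ψ = 0
    · simp [bad, hψ]
    set B := Finset.univ.filter fun t => ‖1 - ψ t‖ ^ 2 < 1 / 2
    have h1 := sum_two_pow_card_inter_le B (two_mul_card_near_one_le hψ) k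
    -- Markov's inequality: a bad `S` has at least `3k/4` elements in `B`.
    have h2 : ((bad ψ).card : ℝ) * 2 ^ (3 / 4 * k : ℝ)
        ≤ ∑ S ∈ Finset.univ.powersetCard k, (2 : ℝ) ^ (S ∩ B).card := by
      rw [← nsmul_eq_mul]
      refine (Finset.card_nsmul_le_sum (bad ψ) (fun S => (2 : ℝ) ^ (S ∩ B).card) _
        fun S hS => ?_).trans (Finset.sum_le_sum_of_subset_of_nonneg (Finset.filter_subset _ _)
          fun _ _ _ => by positivity)
      simp only [bad, Finset.mem_filter, Finset.mem_powersetCard] at hS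
      have h3 := three_mul_card_le_of_sum_lt hS.2.2
      rw [hS.1.2] at h3
      have h4 : (3 * k : ℝ) ≤ 4 * (S ∩ B).card := by exact_mod_cast h3
      rw [← Real.rpow_natCast 2 (S ∩ B).card]
      exact Real.rpow_le_rpow_of_exponent_le one_le_two (by linarith)
    have h5 := mul_le_mul_of_nonneg_left (sq_mul_three_halves_pow_le hn hk)
      (Nat.cast_nonneg (α := ℝ) (bad ψ).card)
    have h6 : (3 / 2 : ℝ) ^ k * (n ^ 2 * (bad ψ).card) ≤ (3 / 2) ^ k * n.choose k := by
      linarith [h5.trans (h2.trans h1)]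
    exact_mod_cast le_of_mul_le_mul_left h6 (by positivity)
  have hsub : ((Finset.univ.powersetCard k).filter fun S : Finset G => ¬ HasCharacterGap S)
      ⊆ Finset.univ.biUnion bad := by
    intro S hS
    simp only [HasCharacterGap, not_forall, not_le, Finset.mem_filter] at hS
    obtain ⟨hS, ψ, hψ, h⟩ := hS
    simp only [Finset.mem_biUnion, bad, Finset.mem_filter]
    exact ⟨ψ, Finset.mem_univ _, hS, hψ, h⟩
  -- The union over the `n` characters uses up one of the two factors `n` in `hbad`.
  refine Nat.le_of_mul_le_mul_left ?_ hn
  calc n * (n * _) ≤ n * (n * ∑ ψ, (bad ψ).card) := by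
        gcongr
        exact (Finset.card_le_card hsub).trans Finset.card_biUnion_le
    _ = ∑ ψ, n ^ 2 * (bad ψ).card := by rw [← Finset.mul_sum, ← mul_assoc, sq]
    _ ≤ ∑ _ψ : AddChar G ℂ, n.choose k := Finset.sum_le_sum fun ψ _ => hbad ψ
    _ = n * n.choose k := by
        rw [Finset.sum_const, Finset.card_univ, AddChar.card_eq, smul_eq_mul]

/-- The bound for fixed `k` has the same factor `n` for all `k ∈ K`, so it can be summed over the
cardinalities. -/
theorem mul_ncard_cyclicSubsets_not_gap_le {n : ℕ} [NeZero n] {K : Set ℕ}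
    (hK : ∀ k ∈ K, 100 * Real.log n ≤ k) :
    n * {S ∈ cyclicSubsets n K | ¬ HasCharacterGap (G := ZMod n) S}.ncard
      ≤ (cyclicSubsets n K).ncard := by
  classical
  change n * Set.ncard (α := Finset (ZMod n)) {S | S.card ∈ K ∧ ¬ HasCharacterGap S}
    ≤ Set.ncard (α := Finset (ZMod n)) {S | S.card ∈ K}
  rw [← Finset.coe_filter_univ, ← Finset.coe_filter_univ, Set.ncard_coe_finset,
    Set.ncard_coe_finset]
  have h3 (A : Finset (Finset (ZMod n))) :
      A.card = ∑ k ∈ Finset.range (n + 1), (A.filter fun S => S.card = k).card := by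
    refine Finset.card_eq_sum_card_fiberwise fun S _ => ?_
    have := Finset.card_le_univ S
    rw [ZMod.card] at this
    simpa [Nat.lt_succ_iff] using this
  rw [h3, h3 (Finset.univ.filter fun S : Finset (ZMod n) => S.card ∈ K), Finset.mul_sum]
  refine Finset.sum_le_sum fun k _ => ?_
  by_cases hk : k ∈ K
  · have h4 := card_mul_card_filter_not_gap_le (G := ZMod n) (k := k)
      (by rw [ZMod.card]; exact hK k hk)
    rw [ZMod.card] at h4
    have h5 : (Finset.univ.filter fun S : Finset (ZMod n) => S.card ∈ K).filter
        (fun S => S.card = k) = Finset.univ.powersetCard k := by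
      ext S
      simp only [Finset.mem_filter, Finset.mem_univ, true_and, Finset.mem_powersetCard,
        Finset.subset_univ]
      exact ⟨fun h => h.2, fun h => ⟨h ▸ hk, h⟩⟩
    rw [h5, Finset.card_powersetCard, Finset.card_univ, ZMod.card]
    refine le_trans (Nat.mul_le_mul_left n (Finset.card_le_card fun S hS => ?_)) h4
    simp only [Finset.mem_filter, Finset.mem_univ, true_and, Finset.mem_powersetCard,
      Finset.subset_univ] at hS ⊢
    exact ⟨hS.2, hS.1.2⟩
  · rw [Finset.card_eq_zero.2, mul_zero]
    · exact Nat.zero_le _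
    · rw [Finset.filter_eq_empty_iff]
      rintro S hS rfl
      exact hk (Finset.mem_filter.1 hS).2.1

end RandomSubset

/-! ### From counting to probabilities and limits. -/

section Probability

theorem uniformProb_le_one {Ω : Type*} [Finite Ω] (A E : Set Ω) : uniformProb A E ≤ 1 :=
  div_le_one_of_le₀ (by exact_mod_cast Set.ncard_le_ncard Set.inter_subset_left)
    (Nat.cast_nonneg _)

/-- If all but a `1 / n` proportion of `A` lies in a subset of `B ∩ E`, where `B ⊆ A`, then `E` has
probability at least `1 - 1 / n` conditionally on `B`. -/
theorem one_sub_inv_le_uniformProb {Ω : Type*} [Finite Ω] {n : ℕ} (hn : 2 ≤ n) {A B E : Set Ω}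
    {P : Ω → Prop} (hA : A.Nonempty) (hbad : n * {x ∈ A | ¬ P x}.ncard ≤ A.ncard)
    (hB : B ⊆ A) (hgood : ∀ x ∈ A, P x → x ∈ B ∩ E) :
    1 - (n : ℝ)⁻¹ ≤ uniformProb B E := by
  have hn0 : (0 : ℝ) < n := by exact_mod_cast (by omega : 0 < n)
  have h1 : A.ncard ≤ {x ∈ A | ¬ P x}.ncard + (B ∩ E).ncard :=
    (Set.ncard_le_ncard fun x hx => by
      by_cases hP : P x
      · exact Or.inr (hgood x hx hP)
      · exact Or.inl ⟨hx, hP⟩).trans (Set.ncard_union_le _ _)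
  have hA0 : 0 < A.ncard := hA.ncard_pos
  have hBA : B.ncard ≤ A.ncard := Set.ncard_le_ncard hB
  have hBE : (B ∩ E).ncard ≤ B.ncard := Set.ncard_le_ncard Set.inter_subset_left
  -- Here `2 ≤ n` matters: some element is good, so `B` is nonempty and the quotient is a genuine
  -- probability.
  have hlt : {x ∈ A | ¬ P x}.ncard < A.ncard := by nlinarith
  have hB0 : (0 : ℝ) < B.ncard := by exact_mod_cast (by omega : 0 < B.ncard)
  rw [uniformProb, le_div_iff₀ hB0]
  have h2 : (n : ℝ) * {x ∈ A | ¬ P x}.ncard ≤ A.ncard := by exact_mod_cast hbad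
  have h3 : (A.ncard : ℝ) ≤ {x ∈ A | ¬ P x}.ncard + (B ∩ E).ncard := by exact_mod_cast h1
  have h4 : (B.ncard : ℝ) ≤ A.ncard := by exact_mod_cast hBA
  have h5 : ({x ∈ A | ¬ P x}.ncard : ℝ) ≤ (n : ℝ)⁻¹ * A.ncard := by
    rw [inv_mul_eq_div, le_div_iff₀ hn0]
    linarith
  have h6 : (0 : ℝ) ≤ 1 - (n : ℝ)⁻¹ :=
    sub_nonneg.2 (inv_le_one_of_one_le₀ (by exact_mod_cast (by omega : 1 ≤ n)))
  nlinarith [mul_le_mul_of_nonneg_left h4 h6]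

theorem tendsto_one_of_one_sub_inv_le {u : ℕ → ℝ} (h : ∀ᶠ n : ℕ in atTop, 1 - (n : ℝ)⁻¹ ≤ u n)
    (h' : ∀ᶠ n : ℕ in atTop, u n ≤ 1) : Tendsto u atTop (𝓝 1) := by
  refine tendsto_of_tendsto_of_tendsto_of_le_of_le' ?_ tendsto_const_nhds h h'
  simpa using (tendsto_const_nhds (x := (1 : ℝ))).sub
    (tendsto_inv_atTop_zero.comp tendsto_natCast_atTop_atTop)

theorem cyclicSubsets_nonempty {n : ℕ} [NeZero n] {K : Set ℕ} {k : ℕ} (hk : k ∈ K) (hkn : k ≤ n) :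
    (cyclicSubsets n K).Nonempty := by
  obtain ⟨S, -, hS⟩ := Finset.exists_subset_card_eq
    (s := (Finset.univ : Finset (CyclicGrp n))) (n := k)
    (by rw [Finset.card_univ, Fintype.card_multiplicative, ZMod.card]; exact hkn)
  exact ⟨S, show S.card ∈ K from hS ▸ hk⟩

/-- Needed separately because the empty set satisfies `HasCharacterGap` trivially. -/
theorem nonempty_of_mem_cyclicSubsets {n : ℕ} (hn : 2 ≤ n) {K : Set ℕ}
    (hK : ∀ k ∈ K, 100 * Real.log n ≤ k) {S : Finset (CyclicGrp n)} (hS : S ∈ cyclicSubsets n K) :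
    S.Nonempty := by
  rw [← Finset.card_pos]
  have h1 := hK _ hS
  have h2 : 0 < Real.log n := Real.log_pos (by exact_mod_cast hn)
  exact_mod_cast (by linarith : (0 : ℝ) < S.card)

theorem mem_generatingSubsets_of_gap {n : ℕ} [NeZero n] {S : Finset (CyclicGrp n)}
    (hne : S.Nonempty) (hS : HasCharacterGap (G := ZMod n) S) : S ∈ generatingSubsets n := by
  let S' : Finset (ZMod n) := S
  have h : AddSubgroup.closure (S' : Set (ZMod n)) = ⊤ :=
    HasCharacterGap.closure_eq_top (S := S') hS hne
  change Subgroup.closure (S : Set (CyclicGrp n)) = ⊤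
  have h1 := congrArg AddSubgroup.toSubgroup h
  rw [AddSubgroup.toSubgroup_closure] at h1
  exact h1

end Probability

/-- Let `K n` be nonempty sets of integers between `100 log n` and `n` (for instance one prescribed
cardinality `k n`, or all integers of this range). A uniformly random subset `S` of `C_n` with
`|S| ∈ K n` generates `C_n` asymptotically almost surely; and, for a universal constant `c > 0`,
if `S` is conditioned to generate `C_n`, then asymptotically almost surely the Euclidean distortion
of `C_2 ≀ C_n` with the word metric of the generators given by `S` is at least `c √n`. -/
theorem proposition3p4 :
    ∃ c : ℝ, 0 < c ∧
      ∀ K : ℕ → Set ℕ,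
        (∀ᶠ n : ℕ in atTop, (K n).Nonempty ∧ ∀ k ∈ K n, 100 * Real.log n ≤ k ∧ k ≤ n) →
        Tendsto (fun n : ℕ => uniformProb (cyclicSubsets n (K n)) (generatingSubsets n))
          atTop (𝓝 1) ∧
        Tendsto (fun n : ℕ => uniformProb (cyclicSubsets n (K n) ∩ generatingSubsets n)
            {S | ENNReal.ofReal (c * √(n : ℝ)) ≤
              euclideanDistortion (WordMetricSpace (lamplighterGenerators S))})
          atTop (𝓝 1) := by
  refine ⟨1 / 14, by norm_num, fun K hK => ⟨?_, ?_⟩⟩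
  all_goals
    refine tendsto_one_of_one_sub_inv_le ?_ ?_
    · filter_upwards [hK, eventually_ge_atTop 2] with n ⟨⟨k, hk⟩, hKn⟩ hn
      have : NeZero n := ⟨by omega⟩
      -- For both limits the good property is the gap; `B` is all of `cyclicSubsets n (K n)` in the
      -- first and its generating members in the second.
      refine one_sub_inv_le_uniformProb hn (cyclicSubsets_nonempty hk (hKn k hk).2)
        (mul_ncard_cyclicSubsets_not_gap_le fun k hk => (hKn k hk).1)
        (by first | exact Set.Subset.rfl | exact Set.inter_subset_left) fun S hS hgap => ?_
      have hne := nonempty_of_mem_cyclicSubsets hn (fun k hk => (hKn k hk).1) hS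
      have hgen := mem_generatingSubsets_of_gap hne hgap
      first
        | exact ⟨hS, hgen⟩
        | exact ⟨⟨hS, hgen⟩, le_euclideanDistortion_of_gap hne hgap⟩
    · filter_upwards [eventually_ge_atTop 1] with n hn
      have : NeZero n := ⟨by omega⟩
      exact uniformProb_le_one _ _
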